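/- Let $\Theta\subseteq\mathbb{R}$ be a non-degenerate closed interval (the real line, a closed half-line, or a compact interval $[a,b]$ with $a<b$). Let $p\in[1,\infty)$, let $\mathcal{P}_p(\Theta)$ be the set of Borel probability measures on $\Theta$ with $\int|\theta|^p\,dG(\theta)<\infty$, and for $G_1,G_2\in\mathcal{P}_p(\Theta)$ let $$W_p(G_1,G_2)=\inf_{\gamma}\Big(\iint|\theta'-\theta|^p\,d\gamma(\theta',\theta)\Big)^{1/p},$$ the infimum being over all couplings $\gamma$ of $G_1$ and $G_2$. Let $\mathcal{P}_*(\Theta)$ be the set of Borel probability measures on $\Theta$ whose support is a non-degenerate compact interval. For a probability measure $G$ on $\Theta$ with finite mean, the sequential barycenter array (SBA) of $G$ is the triangular array $\mu_{j,l}$, $j\ge1$, $1\le l\le 2^j-1$, defined as follows, with $\mu_{j,0}=\inf\Theta$ and $\mu_{j,2^j}=\sup\Theta$. Let $\mu_{1,1}=\int\theta\,dG(\theta)$. Given level $j$, let $\Theta_{j,l}=\Theta\cap(\mu_{j,l-1},\mu_{j,l}]$ for $1\le l\le 2^j$, where the first interval $\Theta_{j,1}$ moreover includes the left endpoint of $\Theta$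 if that is finite. Then $\mu_{j+1,2l}=\mu_{j,l}$ for $1\le l\le 2^j-1$, and, for $1\le l\le 2^j$, $\mu_{j+1,2l-1}$ is the barycenter $\frac{1}{G(\Theta_{j,l})}\int_{\Theta_{j,l}}\theta\,dG(\theta)$ of $\Theta_{j,l}$ if $G(\Theta_{j,l})>0$, and $\mu_{j+1,2l-1}=\mu_{j,l-1}$ otherwise. The level $n$ SBA approximation of $G$, $n\geq 1$, is $$G^{(n)}=\sum_{l=1}^{2^n}G(\Theta_{n,l})\,\delta_{\mu_{n+1,2l-1}}.$$ Let $G_0\in\mathcal{P}_p(\Theta)$. Then for every neighborhood $V$ of $G_0$ in $(\mathcal{P}_p(\Theta),W_p)$ there are $G\in V\cap\mathcal{P}_*(\Theta)$ and $n\ge1$ such that $G^{(n)}\in V$. If $G_0\in\mathcal{P}_*(\Theta)$, then one may choose $G=G_0$ for every $V$; in this case $G_0^{(n)}\in\mathcal{P}_p(\Theta)$ for all $n\geq 1$ and $W_p(G_0^{(n)},G_0)\to0$ as $n\to\infty$. -/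

import Mathlib

open MeasureTheory Filter Topology
open scoped ENNReal

namespace SBA

/-!
Throughout, `Θ` is a closed interval of the real line, and a probability measure on `Θ` is
represented by a probability measure `G` on `ℝ` with `G Θᶜ = 0`.
-/

/-- The probability measures on `Θ`. -/
def probMeasures (Θ : Set ℝ) : Set (Measure ℝ) :=
  {G | IsProbabilityMeasure G ∧ G Θᶜ = 0}

/-- The probability measures on `Θ` with finite `p`-th moment. -/
def finiteMoment (Θ : Set ℝ) (p : ℝ) : Set (Measure ℝ) :=
  {G | G ∈ probMeasures Θ ∧ ∫⁻ θ, ENNReal.ofReal (|θ| ^ p) ∂G < ∞}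

/-- The probability measures on `Θ` whose support is a non-degenerate compact interval. -/
def compactIntervalSupport (Θ : Set ℝ) : Set (Measure ℝ) :=
  {G | G ∈ probMeasures Θ ∧ ∃ a b : ℝ, a < b ∧ G.support = Set.Icc a b}

/-- The couplings of `G₁` and `G₂`. If `G₁` and `G₂` are probability measures on `Θ`,
then every coupling is a probability measure carried by `Θ ×ˢ Θ`. -/
def couplings (G₁ G₂ : Measure ℝ) : Set (Measure (ℝ × ℝ)) :=
  {γ | γ.map Prod.fst = G₁ ∧ γ.map Prod.snd = G₂}

/-- The Wasserstein distance of order `p`, with values in `[0, ∞]`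
(it is finite on measures with finite `p`-th moment). -/
noncomputable def wasserstein (p : ℝ) (G₁ G₂ : Measure ℝ) : ℝ≥0∞ :=
  ⨅ γ ∈ couplings G₁ G₂,
    (∫⁻ z : ℝ × ℝ, ENNReal.ofReal (|z.1 - z.2| ^ p) ∂γ) ^ (1 / p)

/-- `V` is a neighborhood of `G₀`, in the Wasserstein distance of order `p`, in the space of
probability measures on `Θ` with finite `p`-th moment. -/
def IsWassersteinNhd (Θ : Set ℝ) (p : ℝ) (G₀ : Measure ℝ) (V : Set (Measure ℝ)) : Prop :=
  V ⊆ finiteMoment Θ p ∧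
    ∃ ε : ℝ, 0 < ε ∧
      ∀ G ∈ finiteMoment Θ p, wasserstein p G G₀ < ENNReal.ofReal ε → G ∈ V

/-- The barycenter (conditional mean) of `G` on an interval `A` with left endpoint `a`;
it is `a` if `A` has no mass. -/
noncomputable def barycenter (G : Measure ℝ) (A : Set ℝ) (a : ℝ) : ℝ :=
  open Classical in if G A = 0 then a else (∫ θ in A, θ ∂G) / G.real A

/-- The `l`-th of the `2 ^ n` consecutive intervals into which the points
`m 1 ≤ ⋯ ≤ m (2 ^ n - 1)` divide `Θ`, for `1 ≤ l ≤ 2 ^ n`. It is `(m (l - 1), m l]`, except that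
the first interval extends down to the left end of `Θ`, which it contains if it is finite, and
the last one up to the right end of `Θ`, which it contains if it is finite. -/
def cell (Θ : Set ℝ) (n : ℕ) (m : ℕ → ℝ) (l : ℕ) : Set ℝ :=
  {θ | θ ∈ Θ ∧ (1 < l → m (l - 1) < θ) ∧ (l < 2 ^ n → θ ≤ m l)}

/-- The sequential barycenter array of `G`: `array Θ G j l` is `μ_{j,l}`, `1 ≤ l ≤ 2 ^ j - 1`.
Level `0` has no barycenter and its only interval is `Θ`, so that `μ_{1,1}` is the mean of `G`.
The two outer values `l = 0` and `l = 2 ^ j` are the endpoints `inf Θ` and `sup Θ` where these are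
finite; where they are infinite the value there is a placeholder on which nothing depends. -/
noncomputable def array (Θ : Set ℝ) (G : Measure ℝ) : ℕ → ℕ → ℝ
  | 0 => fun l => if l = 0 then sInf Θ else sSup Θ
  | j + 1 => fun l =>
      if l % 2 = 0 then array Θ G j (l / 2)
      else barycenter G (cell Θ j (array Θ G j) (l / 2 + 1)) (array Θ G j (l / 2))

/-- The level `n` SBA approximation of `G`: the mass of each level `n` interval is moved to
the barycenter of that interval. -/
noncomputable def approx (Θ : Set ℝ) (G : Measure ℝ) (n : ℕ) : Measure ℝ :=
  ∑ l ∈ Finset.Icc 1 (2 ^ n),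
    G (cell Θ n (array Θ G n) l) • Measure.dirac (array Θ G (n + 1) (2 * l - 1))

end SBA

namespace SBA

/-! Let `cellMean Θ G n θ` be the barycenter of the level `n` cell of `θ`. Then `G^(n)` is the image
of `G` under this map (`approx_eq_map`), so its distance to `G` is at most the `L^p` distance of the
map to the identity, and it suffices that `cellMean` tends to `θ` almost everywhere.

The cells around `θ` decrease, each cut at its own barycenter. If their intersection `B` has mass,
the barycenters converge to the mean `m` of `B`. Infinitely many cuts of one kind put all of `B` on
one side of `m`; hence `G` restricted to `B` sits at `m`
(`exists_measure_iInter_sdiff_singleton_eq_zero`). When the support is `[a, b]`, `B` therefore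
contains no open subinterval of `[a, b]`. Barycenters staying away from `θ` would force such a
subinterval into `B`, so they converge (`HasFullSupportIcc.ae_tendsto_cellMean`), and dominated
convergence finishes.

For general `G₀`, truncation followed by mixing with a little uniform measure gives a nearby measure
supported on an interval. -/

lemma array_even (Θ : Set ℝ) (G : Measure ℝ) (n k : ℕ) :
    array Θ G (n + 1) (2 * k) = array Θ G n k := by
  simp [array]

lemma array_odd (Θ : Set ℝ) (G : Measure ℝ) (n k : ℕ) :
    array Θ G (n + 1) (2 * k + 1)
      = barycenter G (cell Θ n (array Θ G n) (k + 1)) (array Θ G n k) := by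
  have h1 : (2 * k + 1) % 2 ≠ 0 := by omega
  have h2 : (2 * k + 1) / 2 = k := by omega
  simp only [array, if_neg h1, h2]

lemma barycenter_eq_setAverage {G : Measure ℝ} {A : Set ℝ} (hA : G A ≠ 0) (a : ℝ) :
    barycenter G A a = ⨍ x in A, x ∂G := by
  rw [barycenter, if_neg hA, setAverage_eq, smul_eq_mul, div_eq_inv_mul]

section Barycenter

variable {G : Measure ℝ} [IsFiniteMeasure G] {A : Set ℝ}

/-- The points of `A` not above its mean have positive mass, so removing a null set leaves one. With
`N` the complement of a carrier, the point can be taken in that carrier. -/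
lemma exists_le_barycenter (hG : Integrable (fun x : ℝ => x) G) (hA : G A ≠ 0) (a : ℝ)
    {N : Set ℝ} (hN : G N = 0) : ∃ x ∈ A, x ∉ N ∧ x ≤ barycenter G A a := by
  have h := measure_le_setAverage_pos hA (measure_ne_top _ _) hG.integrableOn
  rw [← measure_sdiff_null hN] at h
  obtain ⟨x, ⟨hx, hxm⟩, hxN⟩ := nonempty_of_measure_ne_zero h.ne'
  exact ⟨x, hx, hxN, by rwa [barycenter_eq_setAverage hA]⟩

lemma exists_barycenter_le (hG : Integrable (fun x : ℝ => x) G) (hA : G A ≠ 0) (a : ℝ)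
    {N : Set ℝ} (hN : G N = 0) : ∃ x ∈ A, x ∉ N ∧ barycenter G A a ≤ x := by
  have h := measure_setAverage_le_pos hA (measure_ne_top _ _) hG.integrableOn
  rw [← measure_sdiff_null hN] at h
  obtain ⟨x, ⟨hx, hxm⟩, hxN⟩ := nonempty_of_measure_ne_zero h.ne'
  exact ⟨x, hx, hxN, by rwa [barycenter_eq_setAverage hA]⟩

lemma measure_le_barycenter_ne_zero (hG : Integrable (fun x : ℝ => x) G) (hA : G A ≠ 0) (a : ℝ) :
    G {x ∈ A | x ≤ barycenter G A a} ≠ 0 := by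
  rw [barycenter_eq_setAverage hA]
  exact (measure_le_setAverage_pos hA (measure_ne_top _ _) hG.integrableOn).ne'

end Barycenter

/-! ### Order of the array and splitting of cells -/

lemma measurableSet_cell {Θ : Set ℝ} (hΘ : MeasurableSet Θ) (n : ℕ) (m : ℕ → ℝ) (l : ℕ) :
    MeasurableSet (cell Θ n m l) := by
  have h1 : MeasurableSet {θ : ℝ | 1 < l → m (l - 1) < θ} :=
    MeasurableSet.imp (.const _) measurableSet_Ioi
  have h2 : MeasurableSet {θ : ℝ | l < 2 ^ n → θ ≤ m l} :=
    MeasurableSet.imp (.const _) measurableSet_Iic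
  exact hΘ.inter (h1.inter h2)

lemma ordConnected_cell {Θ : Set ℝ} (hΘ : Θ.OrdConnected) (n : ℕ) (m : ℕ → ℝ) (l : ℕ) :
    (cell Θ n m l).OrdConnected :=
  ⟨fun _ hx _ hy _ hz => ⟨hΘ.out hx.1 hy.1 hz, fun h => (hx.2.1 h).trans_le hz.1,
    fun h => hz.2.trans (hy.2.2 h)⟩⟩

/-- The standing properties of a level of the array: its interior values are ordered, and its
first cell has positive mass. -/
def IsRegularLevel (Θ : Set ℝ) (G : Measure ℝ) (n : ℕ) : Prop :=
  (∀ k, 1 ≤ k → k + 1 < 2 ^ n → array Θ G n k ≤ array Θ G n (k + 1)) ∧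
    G (cell Θ n (array Θ G n) 1) ≠ 0

section Regular

variable {Θ : Set ℝ} {G : Measure ℝ} [IsFiniteMeasure G]

/-- A null cell causes no trouble, its default barycenter being the left endpoint. Index `0` is
excluded because its value may be a placeholder. -/
lemma array_le_array_odd (hG : Integrable (fun x : ℝ => x) G) {n k : ℕ} (hk : 0 < k) :
    array Θ G n k ≤ array Θ G (n + 1) (2 * k + 1) := by
  rw [array_odd]
  by_cases h0 : G (cell Θ n (array Θ G n) (k + 1)) = 0
  · rw [barycenter, if_pos h0]
  · obtain ⟨x, hx, -, hxm⟩ := exists_le_barycenter hG h0 (array Θ G n k) measure_empty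
    exact (hx.2.1 (by omega)).le.trans hxm

lemma IsRegularLevel.array_odd_le (hG : Integrable (fun x : ℝ => x) G) {n : ℕ}
    (h : IsRegularLevel Θ G n) {k : ℕ} (hk : k + 1 < 2 ^ n) :
    array Θ G (n + 1) (2 * k + 1) ≤ array Θ G n (k + 1) := by
  rw [array_odd]
  by_cases h0 : G (cell Θ n (array Θ G n) (k + 1)) = 0
  · rw [barycenter, if_pos h0]
    -- For `k = 0` the default would be the possibly meaningless outer value; a charged first cell
    -- rules this out.
    rcases Nat.eq_zero_or_pos k with rfl | hk0
    · exact absurd h0 h.2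
    · exact h.1 k hk0 hk
  · obtain ⟨x, hx, -, hxm⟩ := exists_barycenter_le hG h0 (array Θ G n k) measure_empty
    exact hxm.trans (hx.2.2 hk)

lemma IsRegularLevel.mem_cell_left (hG : Integrable (fun x : ℝ => x) G) {n : ℕ}
    (h : IsRegularLevel Θ G n) {k : ℕ} (hk : k < 2 ^ n) (θ : ℝ) :
    θ ∈ cell Θ (n + 1) (array Θ G (n + 1)) (2 * k + 1) ↔
      θ ∈ cell Θ n (array Θ G n) (k + 1) ∧ θ ≤ array Θ G (n + 1) (2 * k + 1) := by
  have hlt : 2 * k + 1 < 2 ^ (n + 1) := by rw [pow_succ]; omega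
  simp only [cell, Set.mem_ofPred_eq, hlt, true_imp_iff, Nat.add_sub_cancel, array_even]
  constructor
  · rintro ⟨h1, h2, h3⟩
    exact ⟨⟨h1, fun hk' => h2 (by omega), fun hk' => h3.trans (h.array_odd_le hG hk')⟩, h3⟩
  · rintro ⟨⟨h1, h2, -⟩, h3⟩
    exact ⟨h1, fun hk' => h2 (by omega), h3⟩

lemma mem_cell_right (hG : Integrable (fun x : ℝ => x) G) {n : ℕ} (k : ℕ) (θ : ℝ) :
    θ ∈ cell Θ (n + 1) (array Θ G (n + 1)) (2 * k + 2) ↔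
      θ ∈ cell Θ n (array Θ G n) (k + 1) ∧ array Θ G (n + 1) (2 * k + 1) < θ := by
  have hlt : 2 * k + 2 < 2 ^ (n + 1) ↔ k + 1 < 2 ^ n := by rw [pow_succ]; omega
  have h1 : 1 < 2 * k + 2 := by omega
  have h2 : 2 * k + 2 - 1 = 2 * k + 1 := by omega
  have h3 : array Θ G (n + 1) (2 * k + 2) = array Θ G n (k + 1) := array_even Θ G n (k + 1)
  simp only [cell, Set.mem_ofPred_eq, hlt, h1, true_imp_iff, h2, h3, Nat.add_sub_cancel]
  constructor
  · rintro ⟨h1, h2, h3⟩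
    exact ⟨⟨h1, fun hk => (array_le_array_odd hG (by omega)).trans_lt h2, h3⟩, h2⟩
  · rintro ⟨⟨h1, -, h3⟩, h2⟩
    exact ⟨h1, h2, h3⟩

lemma isRegularLevel (hG : Integrable (fun x : ℝ => x) G) (hΘ : G Θ ≠ 0) (n : ℕ) :
    IsRegularLevel Θ G n := by
  induction n with
  | zero =>
    refine ⟨fun k hk hk' => by simp at hk', ?_⟩
    simpa [cell] using hΘ
  | succ n ih =>
    constructor
    · intro k hk hk'
      rw [pow_succ] at hk'
      obtain ⟨j, rfl | rfl⟩ := Nat.even_or_odd' k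
      · rw [array_even]
        exact array_le_array_odd hG (by omega)
      · rw [show 2 * j + 1 + 1 = 2 * (j + 1) by ring, array_even]
        exact ih.array_odd_le hG (by omega)
    -- The new first cell is the part of the old one up to its barycenter, which has positive mass.
    · have := measure_le_barycenter_ne_zero hG ih.2 (array Θ G n 0)
      rw [← array_odd Θ G n 0] at this
      convert this using 2
      ext θ
      exact ih.mem_cell_left hG (k := 0) (by positivity) θ

end Regular

/-! ### The cell of a point, and the approximation as an image measure -/

/-- The index `k < 2 ^ n` for which `θ` belongs to the `k + 1`-st cell of level `n`. -/
noncomputable def cellIndex (Θ : Set ℝ) (G : Measure ℝ) : ℕ → ℝ → ℕ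
  | 0 => fun _ => 0
  | n + 1 => fun θ =>
      open Classical in
      if θ ≤ array Θ G (n + 1) (2 * cellIndex Θ G n θ + 1) then 2 * cellIndex Θ G n θ
      else 2 * cellIndex Θ G n θ + 1

lemma cellIndex_succ (Θ : Set ℝ) (G : Measure ℝ) (n : ℕ) (θ : ℝ) :
    cellIndex Θ G (n + 1) θ = 2 * cellIndex Θ G n θ ∧
        θ ≤ array Θ G (n + 1) (2 * cellIndex Θ G n θ + 1) ∨
      cellIndex Θ G (n + 1) θ = 2 * cellIndex Θ G n θ + 1 ∧
        array Θ G (n + 1) (2 * cellIndex Θ G n θ + 1) < θ := by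
  by_cases h : θ ≤ array Θ G (n + 1) (2 * cellIndex Θ G n θ + 1)
  · exact Or.inl ⟨by simp [cellIndex, h], h⟩
  · exact Or.inr ⟨by simp [cellIndex, h], not_le.1 h⟩

lemma cellIndex_lt (Θ : Set ℝ) (G : Measure ℝ) (n : ℕ) (θ : ℝ) : cellIndex Θ G n θ < 2 ^ n := by
  induction n with
  | zero => simp [cellIndex]
  | succ n ih =>
    rw [pow_succ]
    rcases cellIndex_succ Θ G n θ with h | h <;> omega

lemma measurable_cellIndex (Θ : Set ℝ) (G : Measure ℝ) (n : ℕ) :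
    Measurable (cellIndex Θ G n) := by
  induction n with
  | zero => exact measurable_const
  | succ n ih =>
    have h (f : ℕ → ℝ) : Measurable fun θ => f (cellIndex Θ G n θ) :=
      (measurable_from_top (f := f)).comp ih
    have h' (f : ℕ → ℕ) : Measurable fun θ => f (cellIndex Θ G n θ) :=
      (measurable_from_top (f := f)).comp ih
    exact Measurable.ite (measurableSet_le measurable_id
      (h fun k => array Θ G (n + 1) (2 * k + 1))) (h' fun k => 2 * k) (h' fun k => 2 * k + 1)

/-- The level `n` cell of `θ`. -/
def cellOf (Θ : Set ℝ) (G : Measure ℝ) (n : ℕ) (θ : ℝ) : Set ℝ :=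
  cell Θ n (array Θ G n) (cellIndex Θ G n θ + 1)

/-- The barycenter of the level `n` cell of `θ`. -/
noncomputable def cellMean (Θ : Set ℝ) (G : Measure ℝ) (n : ℕ) (θ : ℝ) : ℝ :=
  array Θ G (n + 1) (2 * cellIndex Θ G n θ + 1)

lemma cellMean_eq (Θ : Set ℝ) (G : Measure ℝ) (n : ℕ) (θ : ℝ) : cellMean Θ G n θ =
    barycenter G (cellOf Θ G n θ) (array Θ G n (cellIndex Θ G n θ)) :=
  array_odd Θ G n _

lemma measurable_cellMean (Θ : Set ℝ) (G : Measure ℝ) (n : ℕ) : Measurable (cellMean Θ G n) :=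
  (measurable_from_top (f := fun k => array Θ G (n + 1) (2 * k + 1))).comp
    (measurable_cellIndex Θ G n)

section Cells

variable {Θ : Set ℝ} {G : Measure ℝ} [IsFiniteMeasure G]

/-- The cells partition `Θ`: each splits into two at its barycenter, and the index records the left
and right choices as binary digits. -/
lemma mem_cell_iff (hG : Integrable (fun x : ℝ => x) G) (hΘ : G Θ ≠ 0) (n : ℕ) {k : ℕ}
    (hk : k < 2 ^ n) (θ : ℝ) :
    θ ∈ cell Θ n (array Θ G n) (k + 1) ↔ θ ∈ Θ ∧ cellIndex Θ G n θ = k := by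
  induction n generalizing k with
  | zero =>
    obtain rfl : k = 0 := by simpa using hk
    simp [cell, cellIndex]
  | succ n ih =>
    have hreg := isRegularLevel hG hΘ n
    rw [pow_succ] at hk
    have hsucc := cellIndex_succ Θ G n θ
    obtain ⟨j, rfl | rfl⟩ := Nat.even_or_odd' k
    · rw [hreg.mem_cell_left hG (by omega), ih (by omega), and_assoc]
      refine and_congr_right fun _ => ⟨?_, fun h => ?_⟩
      · rintro ⟨rfl, h⟩
        rcases hsucc with h' | h'
        · exact h'.1
        · exact absurd h h'.2.not_ge
      · obtain ⟨h1, h2⟩ | ⟨h1, h2⟩ := hsucc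
        · obtain rfl : cellIndex Θ G n θ = j := by omega
          exact ⟨rfl, h2⟩
        · omega
    · rw [show 2 * j + 1 + 1 = 2 * j + 2 by ring, mem_cell_right hG, ih (by omega), and_assoc]
      refine and_congr_right fun _ => ⟨?_, fun h => ?_⟩
      · rintro ⟨rfl, h⟩
        rcases hsucc with h' | h'
        · exact absurd h h'.2.not_gt
        · exact h'.1
      · obtain ⟨h1, h2⟩ | ⟨h1, h2⟩ := hsucc
        · omega
        · obtain rfl : cellIndex Θ G n θ = j := by omega
          exact ⟨rfl, h2⟩

lemma mem_cellOf (hG : Integrable (fun x : ℝ => x) G) (hΘ : G Θ ≠ 0) (n : ℕ) {θ : ℝ}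
    (hθ : θ ∈ Θ) : θ ∈ cellOf Θ G n θ :=
  (mem_cell_iff hG hΘ n (cellIndex_lt Θ G n θ) θ).2 ⟨hθ, rfl⟩

lemma cellOf_succ (hG : Integrable (fun x : ℝ => x) G) (hΘ : G Θ ≠ 0) (n : ℕ) (θ : ℝ) :
    cellOf Θ G (n + 1) θ = cellOf Θ G n θ ∩ Set.Iic (cellMean Θ G n θ) ∨
      cellOf Θ G (n + 1) θ = cellOf Θ G n θ ∩ Set.Ioi (cellMean Θ G n θ) := by
  have hreg := isRegularLevel hG hΘ n
  rcases cellIndex_succ Θ G n θ with ⟨h, -⟩ | ⟨h, -⟩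
  · left
    ext x
    rw [cellOf, h]
    exact hreg.mem_cell_left hG (cellIndex_lt Θ G n θ) x
  · right
    ext x
    rw [cellOf, h]
    exact mem_cell_right hG _ x

lemma antitone_cellOf (hG : Integrable (fun x : ℝ => x) G) (hΘ : G Θ ≠ 0) (θ : ℝ) :
    Antitone fun n => cellOf Θ G n θ := by
  refine antitone_nat_of_succ_le fun n => ?_
  rcases cellOf_succ hG hΘ n θ with h | h <;> rw [h] <;> exact Set.inter_subset_left

lemma ae_measure_cellOf_ne_zero (hG : Integrable (fun x : ℝ => x) G) (hΘ : G Θᶜ = 0)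
    (hΘ' : G Θ ≠ 0) : ∀ᵐ θ ∂G, ∀ n, G (cellOf Θ G n θ) ≠ 0 := by
  rw [ae_all_iff]
  intro n
  have key : ∀ k : ℕ, ∀ᵐ θ ∂G, G (cell Θ n (array Θ G n) (k + 1)) = 0 →
      θ ∉ cell Θ n (array Θ G n) (k + 1) := by
    intro k
    by_cases h : G (cell Θ n (array Θ G n) (k + 1)) = 0
    · filter_upwards [measure_eq_zero_iff_ae_notMem.1 h] with θ hθ _ using hθ
    · exact ae_of_all _ fun θ h' => absurd h' h
  have hmem : ∀ᵐ θ ∂G, θ ∈ Θ := hΘ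
  filter_upwards [ae_all_iff.2 key, hmem] with θ h hθ h0
  exact h _ h0 (mem_cellOf hG hΘ' n hθ)

lemma approx_eq_map (hG : Integrable (fun x : ℝ => x) G) (hΘ : G Θᶜ = 0) (hΘ' : G Θ ≠ 0)
    (n : ℕ) : approx Θ G n = G.map (cellMean Θ G n) := by
  have hcell : ∀ k < 2 ^ n, G (cell Θ n (array Θ G n) (k + 1)) = G (cellIndex Θ G n ⁻¹' {k}) := by
    intro k hk
    have hmem : ∀ᵐ θ ∂G, θ ∈ Θ := hΘ
    refine measure_congr ?_
    filter_upwards [hmem] with θ hθ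
    exact propext ((mem_cell_iff hG hΘ' n hk θ).trans (and_iff_right hθ))
  have hsum : approx Θ G n = ∑ k ∈ Finset.range (2 ^ n),
      G (cellIndex Θ G n ⁻¹' {k}) • Measure.dirac (array Θ G (n + 1) (2 * k + 1)) := by
    rw [approx, Finset.sum_bij' (fun l _ => l - 1) (fun k _ => k + 1)]
    · intro l hl; simp only [Finset.mem_Icc, Finset.mem_range] at *; omega
    · intro k hk; simp only [Finset.mem_Icc, Finset.mem_range] at *; omega
    · intro l hl; simp only [Finset.mem_Icc] at hl; omega
    · intro k hk; simp
    · intro l hl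
      simp only [Finset.mem_Icc] at hl
      obtain ⟨k, rfl⟩ : ∃ k, l = k + 1 := ⟨l - 1, by omega⟩
      rw [hcell k (by omega), Nat.add_sub_cancel, show 2 * (k + 1) - 1 = 2 * k + 1 by omega]
  rw [hsum]
  ext S hS
  rw [Measure.map_apply (measurable_cellMean Θ G n) hS, Measure.finsetSum_apply]
  have hpre : ∀ k, MeasurableSet (cellIndex Θ G n ⁻¹' {k}) := fun k =>
    measurable_cellIndex Θ G n (measurableSet_singleton k)
  have huniv : cellIndex Θ G n ⁻¹' (Finset.range (2 ^ n) : Set ℕ) = Set.univ := by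
    ext θ
    simpa using cellIndex_lt Θ G n θ
  -- Decompose the preimage of `S` by cell index; `cellMean` is constant on each piece.
  have := sum_measure_preimage_singleton (μ := G.restrict (cellMean Θ G n ⁻¹' S))
    (Finset.range (2 ^ n)) (f := cellIndex Θ G n) fun k _ => hpre k
  rw [huniv, Measure.restrict_apply_univ] at this
  rw [← this]
  refine Finset.sum_congr rfl fun k _ => ?_
  rw [Measure.restrict_apply (hpre k), Measure.smul_apply, Measure.dirac_apply' _ hS, smul_eq_mul]
  by_cases hk : array Θ G (n + 1) (2 * k + 1) ∈ S
  · rw [Set.indicator_of_mem hk, Pi.one_apply, mul_one]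
    congr 1
    ext θ
    simp only [Set.mem_preimage, Set.mem_singleton_iff, Set.mem_inter_iff, cellMean]
    exact ⟨fun h => ⟨h, by rwa [h]⟩, fun h => h.1⟩
  · rw [Set.indicator_of_notMem hk, mul_zero, eq_comm]
    convert measure_empty (μ := G)
    ext θ
    simp only [Set.mem_preimage, Set.mem_singleton_iff, Set.mem_inter_iff, cellMean,
      Set.mem_empty_iff_false, iff_false]
    rintro ⟨rfl, h⟩
    exact hk h

end Cells

/-! ### Almost everywhere convergence of the barycenters -/

/-- If a decreasing sequence of sets is always cut at the barycenter of the current set, then the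
intersection carries at most an atom. -/
lemma exists_measure_iInter_sdiff_singleton_eq_zero {G : Measure ℝ} [IsFiniteMeasure G]
    (hG : Integrable (fun x : ℝ => x) G) {A : ℕ → Set ℝ} (hA : ∀ n, MeasurableSet (A n))
    (hanti : Antitone A) (a : ℕ → ℝ)
    (hcut : ∀ n, A (n + 1) ⊆ Set.Iic (barycenter G (A n) (a n)) ∨
      A (n + 1) ⊆ Set.Ioi (barycenter G (A n) (a n))) :
    ∃ m, G ((⋂ n, A n) \ {m}) = 0 := by
  set B : Set ℝ := ⋂ n, A n with hBdef
  have hBm : MeasurableSet B := .iInter hA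
  by_cases hB : G B = 0
  · exact ⟨0, measure_mono_null Set.sdiff_subset hB⟩
  have hBn : ∀ n, B ⊆ A n := fun n => Set.iInter_subset _ n
  have hAn : ∀ n, G (A n) ≠ 0 := fun n h => hB (measure_mono_null (hBn n) h)
  have hBr : G.real B ≠ 0 := by simpa [Measure.real, ENNReal.toReal_eq_zero_iff] using hB
  set m : ℝ := (∫ x in B, x ∂G) / G.real B with hm
  have hlim : Tendsto (fun n => barycenter G (A n) (a n)) atTop (𝓝 m) := by
    have h1 : Tendsto (fun n => ∫ x in A n, x ∂G) atTop (𝓝 (∫ x in B, x ∂G)) :=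
      tendsto_setIntegral_of_antitone hA hanti ⟨0, hG.integrableOn⟩
    have h2 : Tendsto (fun n => G.real (A n)) atTop (𝓝 (G.real B)) :=
      (ENNReal.tendsto_toReal (measure_ne_top _ _)).comp
        (tendsto_measure_iInter_atTop (fun n => (hA n).nullMeasurableSet) hanti
          ⟨0, measure_ne_top _ _⟩)
    refine (h1.div h2 hBr).congr fun n => ?_
    rw [barycenter, if_neg (hAn n), Pi.div_apply]
  have hzero : ∫ x in B, (x - m) ∂G = 0 := by
    rw [integral_sub hG.integrableOn (integrable_const m), setIntegral_const, smul_eq_mul, hm,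
      mul_div_cancel₀ _ hBr, sub_self]
  have hint : IntegrableOn (fun x => x - m) B G :=
    hG.integrableOn.sub (integrable_const m)
  -- Either infinitely many cuts keep the left part, or all but finitely many keep the right part;
  -- the bound passes to the limit.
  have hside : (∀ x ∈ B, x ≤ m) ∨ ∀ x ∈ B, m ≤ x := by
    by_cases hfr : ∃ᶠ n in atTop, A (n + 1) ⊆ Set.Iic (barycenter G (A n) (a n))
    · exact Or.inl fun x hx => ge_of_tendsto_of_frequently hlim
        (hfr.mono fun n hn => hn (hBn _ hx))
    · refine Or.inr fun x hx => le_of_tendsto hlim ?_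
      filter_upwards [not_frequently.1 hfr] with n hn
      exact ((hcut n).resolve_left hn (hBn _ hx)).le
  refine ⟨m, ?_⟩
  -- A function of constant sign with integral zero vanishes almost everywhere.
  have hae : (fun x => x - m) =ᵐ[G.restrict B] 0 := by
    rcases hside with h | h
    · have h0 : ∫ x in B, (m - x) ∂G = 0 := by
        rw [← neg_eq_zero, ← integral_neg]
        simpa using hzero
      have hint' : IntegrableOn (fun x => m - x) B G := by
        simpa [Pi.neg_def] using hint.neg
      have := (setIntegral_eq_zero_iff_of_nonneg_ae
        ((ae_restrict_iff' hBm).2 (ae_of_all _ fun x hx => sub_nonneg.2 (h x hx))) hint').1 h0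
      filter_upwards [this] with x hx
      simp only [Pi.zero_apply] at hx ⊢
      linarith
    · exact (setIntegral_eq_zero_iff_of_nonneg_ae
        ((ae_restrict_iff' hBm).2 (ae_of_all _ fun x hx => sub_nonneg.2 (h x hx))) hint).1 hzero
  rw [Filter.EventuallyEq, ae_restrict_iff' hBm] at hae
  refine measure_mono_null ?_ hae
  rintro x ⟨hxB, hxm⟩ hx
  exact hxm (sub_eq_zero.1 (hx hxB))

/-- A probability measure carried by `[a, b]` that charges every open subinterval of `[a, b]`. -/
structure HasFullSupportIcc (G : Measure ℝ) (a b : ℝ) : Prop where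
  prob : IsProbabilityMeasure G
  compl_eq_zero : G (Set.Icc a b)ᶜ = 0
  Ioo_ne_zero : ∀ c d, c < d → Set.Icc c d ⊆ Set.Icc a b → G (Set.Ioo c d) ≠ 0

lemma hasFullSupportIcc_of_support_eq {G : Measure ℝ} [IsProbabilityMeasure G] {a b : ℝ}
    (h : G.support = Set.Icc a b) : HasFullSupportIcc G a b := by
  refine ⟨inferInstance, h ▸ Measure.measure_compl_support, fun c d hcd hsub => ?_⟩
  have hmid : (c + d) / 2 ∈ G.support :=
    h ▸ hsub ⟨by linarith, by linarith⟩
  exact ((Measure.mem_support_iff_forall _).1 hmid _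
    (Ioo_mem_nhds (by linarith) (by linarith))).ne'

section FullSupport

variable {Θ : Set ℝ} {G : Measure ℝ} {a b : ℝ}

lemma HasFullSupportIcc.ae_mem (h : HasFullSupportIcc G a b) : ∀ᵐ θ ∂G, θ ∈ Set.Icc a b :=
  h.compl_eq_zero

lemma HasFullSupportIcc.integrable_id (h : HasFullSupportIcc G a b) :
    Integrable (fun x : ℝ => x) G :=
  have := h.prob
  Integrable.of_mem_Icc a b measurable_id.aemeasurable h.ae_mem

lemma measure_ne_zero_of_compl [IsProbabilityMeasure G] (hΘ : G Θᶜ = 0) : G Θ ≠ 0 := by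
  intro h0
  have := measure_union_le (μ := G) Θ Θᶜ
  simp [h0, hΘ] at this

lemma HasFullSupportIcc.barycenter_mem (h : HasFullSupportIcc G a b) {A : Set ℝ} (hA : G A ≠ 0)
    (c : ℝ) : barycenter G A c ∈ Set.Icc a b := by
  have := h.prob
  obtain ⟨x, -, hx, hxm⟩ := exists_le_barycenter h.integrable_id hA c h.compl_eq_zero
  obtain ⟨y, -, hy, hym⟩ := exists_barycenter_le h.integrable_id hA c h.compl_eq_zero
  exact ⟨(not_not.1 hx).1.trans hxm, hym.trans (not_not.1 hy).2⟩

lemma HasFullSupportIcc.ae_cellMean_mem (h : HasFullSupportIcc G a b) (hΘ : G Θᶜ = 0) :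
    ∀ᵐ θ ∂G, ∀ n, cellMean Θ G n θ ∈ Set.Icc a b := by
  have := h.prob
  filter_upwards [ae_measure_cellOf_ne_zero h.integrable_id hΘ (measure_ne_zero_of_compl hΘ)]
    with θ hθ n
  rw [cellMean_eq]
  exact h.barycenter_mem (hθ n) _

/-- Since the cells are nested, the interval would lie in all of them, hence in a set with at most
an atom `m`. But one half of the interval avoids `m` and is charged. -/
lemma HasFullSupportIcc.not_frequently_Ioo_subset_cellOf (h : HasFullSupportIcc G a b)
    (hΘm : MeasurableSet Θ) (hΘ : G Θᶜ = 0) (θ : ℝ) {c d : ℝ} (hcd : c < d)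
    (hsub : Set.Icc c d ⊆ Set.Icc a b) :
    ¬ ∃ᶠ n in atTop, Set.Ioo c d ⊆ cellOf Θ G n θ := by
  intro hfr
  have := h.prob
  have hG := h.integrable_id
  have hΘ' := measure_ne_zero_of_compl hΘ
  have hanti := antitone_cellOf hG hΘ' θ
  have hall : Set.Ioo c d ⊆ ⋂ n, cellOf Θ G n θ := by
    refine Set.subset_iInter fun n => ?_
    obtain ⟨k, hk, hsub⟩ := (frequently_atTop.1 hfr) n
    exact hsub.trans (hanti hk)
  obtain ⟨m, hm⟩ := exists_measure_iInter_sdiff_singleton_eq_zero hG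
    (A := fun n => cellOf Θ G n θ) (fun n => measurableSet_cell hΘm n _ _) hanti
    (fun n => array Θ G n (cellIndex Θ G n θ)) fun n => by
      simp only [← cellMean_eq]
      rcases cellOf_succ hG hΘ' n θ with h' | h' <;> rw [h']
      · exact Or.inl Set.inter_subset_right
      · exact Or.inr Set.inter_subset_right
  have hcase : ∀ c' d', c' < d' → c ≤ c' → d' ≤ d → m ∉ Set.Ioo c' d' → False := by
    intro c' d' hcd' hc hd hmem
    refine h.Ioo_ne_zero c' d' hcd' ((Set.Icc_subset_Icc hc hd).trans hsub)
      (measure_mono_null (fun x hx => ?_) hm)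
    refine ⟨hall ⟨hc.trans_lt hx.1, hx.2.trans_le hd⟩, ?_⟩
    rintro rfl
    exact hmem hx
  rcases le_total m ((c + d) / 2) with hm' | hm'
  · exact hcase ((c + d) / 2) d (by linarith) (by linarith) le_rfl fun hx => hx.1.not_ge hm'
  · exact hcase c ((c + d) / 2) (by linarith) le_rfl (by linarith) fun hx => hx.2.not_ge hm'

lemma HasFullSupportIcc.ae_tendsto_cellMean (h : HasFullSupportIcc G a b)
    (hΘm : MeasurableSet Θ) (hΘo : Θ.OrdConnected) (hΘ : G Θᶜ = 0) :
    ∀ᵐ θ ∂G, Tendsto (fun n => cellMean Θ G n θ) atTop (𝓝 θ) := by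
  have := h.prob
  have hG := h.integrable_id
  have hΘ' := measure_ne_zero_of_compl hΘ
  have hmemΘ : ∀ᵐ θ ∂G, θ ∈ Θ := hΘ
  filter_upwards [ae_measure_cellOf_ne_zero hG hΘ hΘ', h.ae_mem, hmemΘ] with θ hpos hθ hθΘ
  have hmem : ∀ n, cellMean Θ G n θ ∈ Set.Icc a b := fun n => by
    rw [cellMean_eq]
    exact h.barycenter_mem (hpos n) _
  refine tendsto_order.2 ⟨fun c hc => ?_, fun d hd => ?_⟩ <;> by_contra hcon
  · have hfr := not_eventually.1 hcon
    have hac : a ≤ c := by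
      obtain ⟨n, hn⟩ := hfr.exists
      exact (hmem n).1.trans (not_lt.1 hn)
    -- A cell with barycenter at most `c` has a point at most `c`. It also contains `θ`, hence
    -- everything between.
    refine h.not_frequently_Ioo_subset_cellOf hΘm hΘ θ hc (Set.Icc_subset_Icc hac hθ.2)
      (hfr.mono fun n hn => ?_)
    obtain ⟨x, hx, -, hxm⟩ := exists_le_barycenter hG (hpos n)
      (array Θ G n (cellIndex Θ G n θ)) measure_empty
    rw [← cellMean_eq] at hxm
    exact Set.Ioo_subset_Icc_self.trans ((Set.Icc_subset_Icc_left (hxm.trans (not_lt.1 hn))).trans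
      ((ordConnected_cell hΘo n _ _).out hx (mem_cellOf hG hΘ' n hθΘ)))
  · have hfr := not_eventually.1 hcon
    have hdb : d ≤ b := by
      obtain ⟨n, hn⟩ := hfr.exists
      exact (not_lt.1 hn).trans (hmem n).2
    refine h.not_frequently_Ioo_subset_cellOf hΘm hΘ θ hd (Set.Icc_subset_Icc hθ.1 hdb)
      (hfr.mono fun n hn => ?_)
    obtain ⟨x, hx, -, hxm⟩ := exists_barycenter_le hG (hpos n)
      (array Θ G n (cellIndex Θ G n θ)) measure_empty
    rw [← cellMean_eq] at hxm
    exact Set.Ioo_subset_Icc_self.trans ((Set.Icc_subset_Icc_right ((not_lt.1 hn).trans hxm)).trans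
      ((ordConnected_cell hΘo n _ _).out (mem_cellOf hG hΘ' n hθΘ) hx))

lemma HasFullSupportIcc.tendsto_lintegral_cellMean_sub (h : HasFullSupportIcc G a b)
    (hΘm : MeasurableSet Θ) (hΘo : Θ.OrdConnected) (hΘ : G Θᶜ = 0) {p : ℝ} (hp : 0 < p) :
    Tendsto (fun n => ∫⁻ θ, ENNReal.ofReal (|cellMean Θ G n θ - θ| ^ p) ∂G) atTop (𝓝 0) := by
  have := h.prob
  have hlim := tendsto_lintegral_of_dominated_convergence (μ := G)
    (F := fun n θ => ENNReal.ofReal (|cellMean Θ G n θ - θ| ^ p)) (f := fun _ => 0)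
    (fun _ => ENNReal.ofReal ((b - a) ^ p)) ?_ ?_ ?_ ?_
  · simpa using hlim
  · intro n
    have := measurable_cellMean Θ G n
    fun_prop
  · intro n
    filter_upwards [h.ae_cellMean_mem hΘ, h.ae_mem] with θ hθ hθ'
    have := hθ n
    gcongr
    rw [abs_le]
    constructor <;> linarith [this.1, this.2, hθ'.1, hθ'.2]
  · simp
  · filter_upwards [h.ae_tendsto_cellMean hΘm hΘo hΘ] with θ hθ
    have h1 : Tendsto (fun n => |cellMean Θ G n θ - θ| ^ p) atTop (𝓝 (|θ - θ| ^ p)) :=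
      ((hθ.sub_const θ).abs).rpow_const (Or.inr hp.le)
    have h2 := ENNReal.tendsto_ofReal h1
    simpa [Real.zero_rpow hp.ne'] using h2

end FullSupport

/-! ### Wasserstein bounds from explicit couplings -/

lemma wasserstein_le_of_mem_couplings (p : ℝ) {G₁ G₂ : Measure ℝ} {γ : Measure (ℝ × ℝ)}
    (hγ : γ ∈ couplings G₁ G₂) : wasserstein p G₁ G₂ ≤
      (∫⁻ z : ℝ × ℝ, ENNReal.ofReal (|z.1 - z.2| ^ p) ∂γ) ^ (1 / p) :=
  iInf₂_le γ hγ

/-- Transporting the first measure by `T` moves it by at most the `L^p` distance of `T` to the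
identity. -/
lemma wasserstein_map_le {p : ℝ} (hp : 1 ≤ p) {G G' : Measure ℝ} {T : ℝ → ℝ}
    (hT : Measurable T) :
    wasserstein p (G.map T) G' ≤
      (∫⁻ θ, ENNReal.ofReal (|T θ - θ| ^ p) ∂G) ^ (1 / p) + wasserstein p G G' := by
  have hp0 : 0 ≤ p := zero_le_one.trans hp
  rw [wasserstein.eq_def p G, ENNReal.add_iInf₂]
  refine le_iInf₂ fun γ hγ => ?_
  have hTm : Measurable fun z : ℝ × ℝ => (T z.1, z.2) := by fun_prop
  -- Moving the first coordinate of `γ` by `T` gives a coupling, whose cost Minkowski's inequality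
  -- bounds. No gluing of couplings is needed.
  refine (wasserstein_le_of_mem_couplings p (γ := γ.map fun z => (T z.1, z.2)) ⟨?_, ?_⟩).trans ?_
  · rw [Measure.map_map measurable_fst hTm, ← hγ.1, Measure.map_map hT measurable_fst]
    rfl
  · rw [Measure.map_map measurable_snd hTm]
    exact hγ.2
  · have h1 : ∫⁻ θ, ENNReal.ofReal (|T θ - θ| ^ p) ∂G =
        ∫⁻ z, ENNReal.ofReal |T z.1 - z.1| ^ p ∂γ := by
      rw [← hγ.1, lintegral_map (by fun_prop) measurable_fst]
      simp_rw [ENNReal.ofReal_rpow_of_nonneg (abs_nonneg _) hp0]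
    have h2 : ∫⁻ z : ℝ × ℝ, ENNReal.ofReal (|z.1 - z.2| ^ p) ∂γ =
        ∫⁻ z : ℝ × ℝ, ENNReal.ofReal |z.1 - z.2| ^ p ∂γ := by
      simp_rw [ENNReal.ofReal_rpow_of_nonneg (abs_nonneg _) hp0]
    rw [h1, h2, lintegral_map (by fun_prop) hTm]
    refine le_trans ?_ (ENNReal.lintegral_Lp_add_le (by fun_prop) (by fun_prop) hp)
    refine ENNReal.rpow_le_rpow (lintegral_mono fun z => ?_) (by positivity)
    rw [← ENNReal.ofReal_rpow_of_nonneg (abs_nonneg _) hp0]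
    refine ENNReal.rpow_le_rpow ?_ hp0
    rw [Pi.add_apply, ← ENNReal.ofReal_add (abs_nonneg _) (abs_nonneg _)]
    exact ENNReal.ofReal_le_ofReal (abs_sub_le _ _ _)

lemma wasserstein_self {p : ℝ} (hp : 0 < p) (G : Measure ℝ) : wasserstein p G G = 0 := by
  have hm : Measurable fun θ : ℝ => (θ, θ) := by fun_prop
  refine le_antisymm ((wasserstein_le_of_mem_couplings p
    (γ := G.map fun θ => (θ, θ)) ⟨?_, ?_⟩).trans ?_) zero_le
  · rw [Measure.map_map measurable_fst hm]
    exact Measure.map_id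
  · rw [Measure.map_map measurable_snd hm]
    exact Measure.map_id
  · rw [lintegral_map (by fun_prop) hm]
    simp [Real.zero_rpow hp.ne', hp]

section CompactSupport

variable {Θ : Set ℝ} {G : Measure ℝ} {a b p : ℝ}

lemma mem_finiteMoment_of_ae_mem_Icc (hp : 0 ≤ p) [IsProbabilityMeasure G] (hΘ : G Θᶜ = 0)
    (h : ∀ᵐ θ ∂G, θ ∈ Set.Icc a b) : G ∈ finiteMoment Θ p := by
  refine ⟨⟨inferInstance, hΘ⟩, ?_⟩
  have hle : ∫⁻ θ, ENNReal.ofReal (|θ| ^ p) ∂G ≤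
      ∫⁻ _, ENNReal.ofReal ((max |a| |b|) ^ p) ∂G := by
    refine lintegral_mono_ae ?_
    filter_upwards [h] with θ hθ
    gcongr
    exact abs_le_max_abs_abs hθ.1 hθ.2
  exact hle.trans_lt (by simp)

lemma HasFullSupportIcc.approx_mem_finiteMoment (h : HasFullSupportIcc G a b)
    (hsub : Set.Icc a b ⊆ Θ) (hΘ : G Θᶜ = 0) (hp : 0 ≤ p) (n : ℕ) :
    approx Θ G n ∈ finiteMoment Θ p := by
  have := h.prob
  have hT := measurable_cellMean Θ G n
  rw [approx_eq_map h.integrable_id hΘ (measure_ne_zero_of_compl hΘ)]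
  have : IsProbabilityMeasure (G.map (cellMean Θ G n)) :=
    Measure.isProbabilityMeasure_map hT.aemeasurable
  have hmem : ∀ᵐ θ ∂(G.map (cellMean Θ G n)), θ ∈ Set.Icc a b := by
    refine (ae_map_iff hT.aemeasurable measurableSet_Icc).2 ?_
    filter_upwards [h.ae_cellMean_mem hΘ] with θ hθ using hθ n
  refine mem_finiteMoment_of_ae_mem_Icc hp ?_ hmem
  exact measure_mono_null (Set.compl_subset_compl.2 hsub) hmem

lemma HasFullSupportIcc.eventually_wasserstein_approx_lt (h : HasFullSupportIcc G a b)
    (hΘc : IsClosed Θ) (hΘo : Θ.OrdConnected) (hΘ : G Θᶜ = 0) (hp : 1 ≤ p) {G₀ : Measure ℝ}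
    {ε : ℝ≥0∞} (hε : wasserstein p G G₀ < ε) :
    ∀ᶠ n in atTop, wasserstein p (approx Θ G n) G₀ < ε := by
  have := h.prob
  have hp0 : 0 < p := zero_lt_one.trans_le hp
  have hlim := ((h.tendsto_lintegral_cellMean_sub hΘc.measurableSet hΘo hΘ hp0).ennrpow_const
    (1 / p)).add_const (wasserstein p G G₀)
  rw [ENNReal.zero_rpow_of_pos (by positivity), zero_add] at hlim
  filter_upwards [hlim.eventually_lt_const hε] with n hn
  rw [approx_eq_map h.integrable_id hΘ (measure_ne_zero_of_compl hΘ)]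
  exact (wasserstein_map_le hp (measurable_cellMean Θ G n)).trans_lt hn

end CompactSupport

/-! ### Density of the measures supported on a compact interval -/

/-- Mixing a transported measure with an independent one. -/
lemma wasserstein_mixture_le {p : ℝ} (G U : Measure ℝ) [IsProbabilityMeasure G]
    [IsProbabilityMeasure U] {T : ℝ → ℝ} (hT : Measurable T) {s t : ℝ≥0∞} (hst : s + t = 1) :
    wasserstein p (s • G.map T + t • U) G ≤
      (s * ∫⁻ θ, ENNReal.ofReal (|T θ - θ| ^ p) ∂G +
        t * ∫⁻ z : ℝ × ℝ, ENNReal.ofReal (|z.1 - z.2| ^ p) ∂(U.prod G)) ^ (1 / p) := by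
  have hm : Measurable fun θ : ℝ => (T θ, θ) := by fun_prop
  refine (wasserstein_le_of_mem_couplings p
    (γ := s • G.map (fun θ => (T θ, θ)) + t • U.prod G) ⟨?_, ?_⟩).trans ?_
  · rw [Measure.map_add _ _ measurable_fst, Measure.map_smul, Measure.map_smul,
      Measure.map_map measurable_fst hm, Measure.map_fst_prod, measure_univ, one_smul]
    rfl
  · rw [Measure.map_add _ _ measurable_snd, Measure.map_smul, Measure.map_smul,
      Measure.map_map measurable_snd hm, Measure.map_snd_prod, measure_univ, one_smul,
      show (Prod.snd ∘ fun θ => (T θ, θ)) = id from rfl, Measure.map_id, ← add_smul, hst, one_smul]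
  · rw [lintegral_add_measure, lintegral_smul_measure, lintegral_smul_measure,
      lintegral_map (by fun_prop) hm]
    rfl

lemma cond_Icc_compl (a b : ℝ) :
    ProbabilityTheory.cond (volume : Measure ℝ) (Set.Icc a b) (Set.Icc a b)ᶜ = 0 := by
  rw [ProbabilityTheory.cond_apply measurableSet_Icc]
  simp

lemma support_mixture_cond {a b : ℝ} (hab : a < b) (G : Measure ℝ)
    (hG : G (Set.Icc a b)ᶜ = 0) (s : ℝ≥0∞) {t : ℝ≥0∞} (ht : t ≠ 0) :
    (s • G + t • ProbabilityTheory.cond volume (Set.Icc a b)).support = Set.Icc a b := by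
  set U := ProbabilityTheory.cond (volume : Measure ℝ) (Set.Icc a b) with hU
  have hUc : U (Set.Icc a b)ᶜ = 0 := cond_Icc_compl a b
  refine subset_antisymm (Measure.support_subset_of_isClosed isClosed_Icc ?_) ?_
  · rw [mem_ae_iff, Measure.add_apply, Measure.smul_apply, Measure.smul_apply, hG, hUc]
    simp
  · rw [← closure_Ioo hab.ne]
    refine closure_minimal (fun x hx => ?_) Measure.isClosed_support
    -- As `t ≠ 0`, the mixture dominates Lebesgue measure on `[a, b]`, so its support contains the
    -- open interval.
    have hac : volume.restrict (Set.Icc a b) ≪ s • G + t • U := by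
      intro S hS
      rw [Measure.add_apply, Measure.smul_apply, Measure.smul_apply, add_eq_zero] at hS
      have h2 : U S = 0 := by simpa [ht] using hS.2
      rw [hU, ProbabilityTheory.cond, Measure.smul_apply] at h2
      simpa using h2
    refine hac.support_mono (Measure.interior_inter_support ⟨?_, ?_⟩)
    · rwa [interior_Icc]
    · rw [Measure.support_eq_univ]
      trivial

lemma lintegral_prod_abs_sub_rpow_lt_top {p : ℝ} (hp : 1 ≤ p) {U G : Measure ℝ}
    [IsProbabilityMeasure U] [IsProbabilityMeasure G] {K : ℝ} (hU : ∀ᵐ u ∂U, |u| ≤ K)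
    (hG : ∫⁻ θ, ENNReal.ofReal (|θ| ^ p) ∂G < ∞) :
    ∫⁻ z : ℝ × ℝ, ENNReal.ofReal (|z.1 - z.2| ^ p) ∂(U.prod G) < ∞ := by
  have hp0 : 0 ≤ p := zero_le_one.trans hp
  have hfst : ∀ᵐ z ∂(U.prod G), |z.1| ≤ K := Measure.quasiMeasurePreserving_fst.ae hU
  have hle : ∫⁻ z : ℝ × ℝ, ENNReal.ofReal (|z.1 - z.2| ^ p) ∂(U.prod G) ≤
      ∫⁻ z : ℝ × ℝ, 2 ^ (p - 1) * (ENNReal.ofReal K ^ p + ENNReal.ofReal (|z.2| ^ p))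
        ∂(U.prod G) := by
    refine lintegral_mono_ae ?_
    filter_upwards [hfst] with z hz
    rw [← ENNReal.ofReal_rpow_of_nonneg (abs_nonneg _) hp0,
      ← ENNReal.ofReal_rpow_of_nonneg (abs_nonneg _) hp0]
    refine le_trans ?_ (ENNReal.rpow_add_le_mul_rpow_add_rpow _ _ hp)
    refine ENNReal.rpow_le_rpow ?_ hp0
    rw [← ENNReal.ofReal_add ((abs_nonneg _).trans hz) (abs_nonneg _)]
    exact ENNReal.ofReal_le_ofReal ((abs_sub _ _).trans (by gcongr))
  refine hle.trans_lt ?_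
  have hsnd : ∫⁻ z : ℝ × ℝ, ENNReal.ofReal (|z.2| ^ p) ∂(U.prod G) =
      ∫⁻ θ, ENNReal.ofReal (|θ| ^ p) ∂G :=
    measurePreserving_snd.lintegral_comp (f := fun θ : ℝ => ENNReal.ofReal (|θ| ^ p))
      (by fun_prop)
  rw [lintegral_const_mul _ (by fun_prop), lintegral_add_left (by fun_prop), hsnd,
    lintegral_const, measure_univ, mul_one]
  refine ENNReal.mul_lt_top (ENNReal.rpow_lt_top_of_nonneg (by linarith) (by simp)) ?_
  exact ENNReal.add_lt_top.2 ⟨ENNReal.rpow_lt_top_of_nonneg hp0 (by simp), hG⟩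

/-- The truncation of `θ` to `[-k, k]`. -/
noncomputable def truncate (k : ℕ) (θ : ℝ) : ℝ := max (-k) (min k θ)

lemma measurable_truncate (k : ℕ) : Measurable (truncate k) := by
  unfold truncate
  fun_prop

lemma truncate_eq_self {k : ℕ} {θ : ℝ} (h : |θ| ≤ k) : truncate k θ = θ := by
  rw [truncate, min_eq_right (abs_le.1 h).2, max_eq_right (abs_le.1 h).1]

lemma truncate_mem_Icc (k : ℕ) (θ : ℝ) : truncate k θ ∈ Set.Icc (-k : ℝ) k :=
  ⟨le_max_left _ _, max_le (by linarith [(Nat.cast_nonneg k : (0 : ℝ) ≤ k)]) (min_le_left _ _)⟩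

lemma abs_truncate_sub_le (k : ℕ) (θ : ℝ) : |truncate k θ - θ| ≤ |θ| := by
  have hk : (0 : ℝ) ≤ k := Nat.cast_nonneg k
  rcases le_total |θ| k with h | h
  · simp [truncate_eq_self h]
  · rcases le_total 0 θ with h0 | h0
    · rw [abs_of_nonneg h0] at *
      rw [truncate, min_eq_left h, max_eq_right (by linarith), abs_le]
      constructor <;> linarith
    · rw [abs_of_nonpos h0] at *
      rw [truncate, min_eq_right (by linarith), max_eq_left (by linarith), abs_le]
      constructor <;> linarith

/-- A truncated value that differs from `θ` lies between `θ` and `x`. -/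
lemma truncate_mem {Θ : Set ℝ} (hΘ : Θ.OrdConnected) {x : ℝ} (hx : x ∈ Θ) {k : ℕ} (hk : |x| ≤ k)
    {θ : ℝ} (hθ : θ ∈ Θ) : truncate k θ ∈ Θ := by
  have hk0 : (0 : ℝ) ≤ k := Nat.cast_nonneg k
  rcases le_total |θ| k with h | h
  · rwa [truncate_eq_self h]
  · rw [abs_le] at hk
    rcases le_total 0 θ with h0 | h0
    · rw [abs_of_nonneg h0] at h
      rw [truncate, min_eq_left h, max_eq_right (by linarith)]
      exact hΘ.out hx hθ ⟨hk.2, h⟩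
    · rw [abs_of_nonpos h0] at h
      rw [truncate, min_eq_right (by linarith), max_eq_left (by linarith)]
      exact hΘ.out hθ hx ⟨by linarith, hk.1⟩

lemma tendsto_lintegral_truncate_sub {p : ℝ} (hp : 0 < p) {G : Measure ℝ}
    (hG : ∫⁻ θ, ENNReal.ofReal (|θ| ^ p) ∂G < ∞) :
    Tendsto (fun k => ∫⁻ θ, ENNReal.ofReal (|truncate k θ - θ| ^ p) ∂G) atTop (𝓝 0) := by
  have hlim := tendsto_lintegral_of_dominated_convergence (μ := G)
    (F := fun k θ => ENNReal.ofReal (|truncate k θ - θ| ^ p)) (f := fun _ => 0)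
    (fun θ => ENNReal.ofReal (|θ| ^ p)) ?_ ?_ hG.ne ?_
  · simpa using hlim
  · intro k
    have := measurable_truncate k
    fun_prop
  · refine fun k => ae_of_all _ fun θ => ?_
    have := abs_truncate_sub_le k θ
    dsimp only
    gcongr
  · refine ae_of_all _ fun θ => tendsto_const_nhds.congr' ?_
    obtain ⟨N, hN⟩ := exists_nat_ge |θ|
    filter_upwards [eventually_ge_atTop N] with k hk
    rw [truncate_eq_self (hN.trans (by exact_mod_cast hk))]
    simp [Real.zero_rpow hp.ne']

/-- The measures whose support is a compact interval are dense for the Wasserstein distance. -/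
lemma exists_compactIntervalSupport_wasserstein_lt {Θ : Set ℝ} (hΘc : IsClosed Θ)
    (hΘo : Θ.OrdConnected) (hΘn : Θ.Nontrivial) {p : ℝ} (hp : 1 ≤ p) {G₀ : Measure ℝ}
    (hG₀ : G₀ ∈ finiteMoment Θ p) {ε : ℝ≥0∞} (hε : 0 < ε) :
    ∃ G ∈ compactIntervalSupport Θ, wasserstein p G G₀ < ε := by
  have hp0 : 0 < p := zero_lt_one.trans_le hp
  obtain ⟨⟨hprob, hG₀Θ⟩, hmom⟩ := hG₀
  obtain ⟨x, hx, y, hy, hxy⟩ := hΘn.exists_lt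
  obtain ⟨N, hN⟩ := exists_nat_ge (max |x| |y|)
  have hlim := (tendsto_lintegral_truncate_sub hp0 hmom).ennrpow_const (1 / p)
  rw [ENNReal.zero_rpow_of_pos (by positivity)] at hlim
  -- `k` makes truncation cheap and keeps two distinct points of `Θ` in `[-k, k]`, so that `K` is
  -- non-degenerate.
  obtain ⟨k, hkε, hkN⟩ := ((hlim.eventually_lt_const hε).and (eventually_ge_atTop N)).exists
  have hNk : (N : ℝ) ≤ k := by exact_mod_cast hkN
  have hxk : |x| ≤ k := (le_max_left _ _).trans (hN.trans hNk)
  have hyk : |y| ≤ k := (le_max_right _ _).trans (hN.trans hNk)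
  set K : Set ℝ := Θ ∩ Set.Icc (-k : ℝ) k with hK
  have hxK : x ∈ K := ⟨hx, abs_le.1 hxk⟩
  have hyK : y ∈ K := ⟨hy, abs_le.1 hyk⟩
  obtain ⟨a, b, hKab⟩ : ∃ a b, K = Set.Icc a b :=
    ⟨_, _, eq_Icc_of_connected_compact
      ⟨⟨x, hxK⟩, (hΘo.inter Set.ordConnected_Icc).isPreconnected⟩
      (isCompact_Icc.inter_left hΘc)⟩
  have hab : a < b := by
    rw [hKab] at hxK hyK
    exact hxK.1.trans_lt (hxy.trans_le hyK.2)
  set U := ProbabilityTheory.cond (volume : Measure ℝ) (Set.Icc a b) with hU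
  have hUprob : IsProbabilityMeasure U :=
    ProbabilityTheory.cond_isProbabilityMeasure_of_finite (by simp [hab]) (by simp)
  have hUmem : ∀ᵐ u ∂U, u ∈ Set.Icc a b := cond_Icc_compl a b
  have hUk : ∀ᵐ u : ℝ ∂U, |u| ≤ k := by
    filter_upwards [hUmem] with u hu
    rw [← hKab] at hu
    exact abs_le.2 hu.2
  have hC := lintegral_prod_abs_sub_rpow_lt_top hp hUk hmom
  have hT := measurable_truncate k
  have hcost : Tendsto (fun n : ℕ => (∫⁻ θ, ENNReal.ofReal (|truncate k θ - θ| ^ p) ∂G₀ +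
      (n : ℝ≥0∞)⁻¹ * ∫⁻ z : ℝ × ℝ, ENNReal.ofReal (|z.1 - z.2| ^ p) ∂(U.prod G₀)) ^ (1 / p))
      atTop (𝓝 ((∫⁻ θ, ENNReal.ofReal (|truncate k θ - θ| ^ p) ∂G₀) ^ (1 / p))) := by
    refine Tendsto.ennrpow_const _ ?_
    simpa using (ENNReal.Tendsto.mul_const ENNReal.tendsto_inv_nat_nhds_zero
      (Or.inr hC.ne)).const_add _
  -- The uniform part gets weight `1 / n`; its transport cost is finite, so a large `n` preserves
  -- the strict bound.
  obtain ⟨n, hnε, hn⟩ := ((hcost.eventually_lt_const hkε).and (eventually_ge_atTop 1)).exists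
  set t : ℝ≥0∞ := (n : ℝ≥0∞)⁻¹ with ht
  have ht0 : t ≠ 0 := by simp [ht]
  have ht1 : t ≤ 1 := ENNReal.inv_le_one.2 (by exact_mod_cast hn)
  have hst : 1 - t + t = 1 := tsub_add_cancel_of_le ht1
  have hTprob : IsProbabilityMeasure (G₀.map (truncate k)) :=
    Measure.isProbabilityMeasure_map hT.aemeasurable
  have hTmem : ∀ᵐ θ ∂(G₀.map (truncate k)), θ ∈ Set.Icc a b := by
    refine (ae_map_iff hT.aemeasurable measurableSet_Icc).2 ?_
    have hΘ : ∀ᵐ θ ∂G₀, θ ∈ Θ := hG₀Θ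
    filter_upwards [hΘ] with θ hθ
    have hmem : truncate k θ ∈ K := ⟨truncate_mem hΘo hx hxk hθ, truncate_mem_Icc k θ⟩
    rwa [hKab] at hmem
  have hsupp := support_mixture_cond hab _ hTmem (1 - t) ht0
  refine ⟨(1 - t) • G₀.map (truncate k) + t • U, ⟨⟨⟨?_⟩, ?_⟩, a, b, hab, hsupp⟩, ?_⟩
  · simp [hst]
  · refine measure_mono_null (Set.compl_subset_compl.2 ?_)
      (Measure.measure_compl_support (μ := (1 - t) • G₀.map (truncate k) + t • U))
    rw [hsupp, ← hKab]
    exact Set.inter_subset_left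
  · refine (wasserstein_mixture_le G₀ U hT hst).trans_lt (lt_of_le_of_lt ?_ hnε)
    gcongr
    exact mul_le_of_le_one_left zero_le tsub_le_self

lemma exists_hasFullSupportIcc {Θ : Set ℝ} (hΘc : IsClosed Θ) {G : Measure ℝ}
    (hG : G ∈ compactIntervalSupport Θ) :
    ∃ a b, HasFullSupportIcc G a b ∧ Set.Icc a b ⊆ Θ := by
  obtain ⟨⟨hprob, hΘ⟩, a, b, -, hsupp⟩ := hG
  exact ⟨a, b, hasFullSupportIcc_of_support_eq hsupp,
    hsupp ▸ Measure.support_subset_of_isClosed hΘc hΘ⟩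

end SBA

theorem theorem3 (Θ : Set ℝ) (hΘ_closed : IsClosed Θ) (hΘ_interval : Θ.OrdConnected)
    (hΘ_nondegenerate : Θ.Nontrivial) (p : ℝ) (hp : 1 ≤ p)
    (G₀ : Measure ℝ) (hG₀ : G₀ ∈ SBA.finiteMoment Θ p) :
    (∀ V : Set (Measure ℝ), SBA.IsWassersteinNhd Θ p G₀ V →
      ∃ G ∈ V, G ∈ SBA.compactIntervalSupport Θ ∧
        ∃ n : ℕ, 1 ≤ n ∧ SBA.approx Θ G n ∈ V) ∧
    (G₀ ∈ SBA.compactIntervalSupport Θ →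
      (∀ V : Set (Measure ℝ), SBA.IsWassersteinNhd Θ p G₀ V →
        G₀ ∈ V ∧ ∃ n : ℕ, 1 ≤ n ∧ SBA.approx Θ G₀ n ∈ V) ∧
      (∀ n : ℕ, 1 ≤ n → SBA.approx Θ G₀ n ∈ SBA.finiteMoment Θ p) ∧
      Tendsto (fun n : ℕ => SBA.wasserstein p (SBA.approx Θ G₀ n) G₀) atTop (𝓝 0)) := by
  have hp0 : 0 < p := zero_lt_one.trans_le hp
  -- Shared by both claims: density supplies `G` in general, while `G₀` itself, at distance zero,
  -- serves in the special case.
  have key : ∀ V : Set (Measure ℝ), ∀ ε : ℝ,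
      (∀ G ∈ SBA.finiteMoment Θ p, SBA.wasserstein p G G₀ < ENNReal.ofReal ε → G ∈ V) →
      ∀ G ∈ SBA.compactIntervalSupport Θ, SBA.wasserstein p G G₀ < ENNReal.ofReal ε →
        G ∈ V ∧ ∃ n : ℕ, 1 ≤ n ∧ SBA.approx Θ G n ∈ V := by
    intro V ε hV G hG hlt
    obtain ⟨a, b, hfull, hsub⟩ := SBA.exists_hasFullSupportIcc hΘ_closed hG
    have := hfull.prob
    refine ⟨hV G (SBA.mem_finiteMoment_of_ae_mem_Icc hp0.le hG.1.2 hfull.ae_mem) hlt, ?_⟩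
    obtain ⟨n, hn, hn1⟩ := ((hfull.eventually_wasserstein_approx_lt hΘ_closed hΘ_interval hG.1.2 hp
      hlt).and (eventually_ge_atTop 1)).exists
    exact ⟨n, hn1, hV _ (hfull.approx_mem_finiteMoment hsub hG.1.2 hp0.le n) hn⟩
  refine ⟨?_, fun hG => ⟨?_, fun n _ => ?_, ?_⟩⟩
  · rintro V ⟨-, ε, hε, hV⟩
    obtain ⟨G, hG, hlt⟩ := SBA.exists_compactIntervalSupport_wasserstein_lt hΘ_closed hΘ_interval
      hΘ_nondegenerate hp hG₀ (ENNReal.ofReal_pos.2 hε)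
    obtain ⟨hGV, hn⟩ := key V ε hV G hG hlt
    exact ⟨G, hGV, hG, hn⟩
  · rintro V ⟨-, ε, hε, hV⟩
    refine key V ε hV G₀ hG ?_
    rw [SBA.wasserstein_self hp0]
    exact ENNReal.ofReal_pos.2 hε
  · obtain ⟨a, b, hfull, hsub⟩ := SBA.exists_hasFullSupportIcc hΘ_closed hG
    exact hfull.approx_mem_finiteMoment hsub hG.1.2 hp0.le n
  · obtain ⟨a, b, hfull, hsub⟩ := SBA.exists_hasFullSupportIcc hΘ_closed hG
    refine ENNReal.tendsto_nhds_zero.2 fun ε hε => ?_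
    refine (hfull.eventually_wasserstein_approx_lt hΘ_closed hΘ_interval hG.1.2 hp
      (ε := ε) ?_).mono fun n hn => hn.le
    rwa [SBA.wasserstein_self hp0]
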